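/- For $n\ge 0$ let $\llbracket n\rrbracket=\{-n,\dots,-1\}\cup\{1,\dots,n\}$. A signed permutation of size $n$ is a permutation $\pi$ of $\llbracket n\rrbracket$ with $\pi(-i)=-\pi(i)$ for all $i$. It is cycle-alternating if every $i\in\llbracket n\rrbracket$ satisfies either $\pi^{-1}(i)<i>\pi(i)$ or $\pi^{-1}(i)>i<\pi(i)$; let $\mathcal C_n$ be the set of cycle-alternating signed permutations of size $n$. For $\pi\in\mathcal C_n$ let $\mathrm{neg}(\pi)$ be the number of $i\in\{1,\dots,n\}$ with $\pi(i)<0$, and let $\mathrm{cro}(\pi)$ be the number of pairs $(i,j)\in\llbracket n\rrbracket^2$ with $i<j<\pi(i)<\pi(j)$. A Dyck prefix of length $n$ is a path of $n$ steps, each of them up ($+1$) or down ($-1$), that starts at height $0$ and never goes below height $0$. Let $\mathcal P_n$ be the set of Dyck prefixes of length $n$ in which each up step from height $h$ to $h+1$ carries a weight $q^i$ with $i\in\{0,\dots,h+1\}$ and each down step from height $h+1$ to $h$ carries a weight $q^i$ with $i\in\{0,\dots,h\}$. Let $\mathcal P'_n\subset\mathcal P_n$ be the subset of paths that have no up step starting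 at a height $h$ with the maximal weight $q^{h+1}$. For $p\in\mathcal P_n$ let $\mathrm{fh}(p)$ be its final height and let $\mathrm{w}(p)$ be the exponent of $q$ in its total weight, which is the product of the weights of its steps. Then for every $n\ge 0$ there is a bijection $\Psi:\mathcal C_n\to\mathcal P'_n$ such that, for every $\pi\in\mathcal C_n$, $$\mathrm{fh}(\Psi(\pi))=\mathrm{neg}(\pi)\qquad\text{and}\qquad \mathrm{w}(\Psi(\pi))=\mathrm{cro}(\pi).$$ -/

import Mathlib

namespace CycAlt

/-- The index set `{-n, …, -1} ∪ {1, …, n}`, with the order inherited from `ℤ`. -/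
abbrev Idx (n : ℕ) : Type := {i : ℤ // i ∈ (Finset.Icc (-(n : ℤ)) (n : ℤ)).erase 0}

/-- The involution `i ↦ -i` of the index set. -/
def Idx.opp {n : ℕ} (i : Idx n) : Idx n :=
  ⟨-i.1, by
    have h := i.2
    simp only [Finset.mem_erase, Finset.mem_Icc, ne_eq] at h ⊢
    omega⟩

/-- Signed permutations of size `n`: permutations `π` of `{-n, …, -1} ∪ {1, …, n}` with
`π (-i) = -π i` for every `i`. -/
def SignedPerm (n : ℕ) : Type :=
  {π : Equiv.Perm (Idx n) // ∀ i, π i.opp = (π i).opp}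

/-- `i` is a cycle peak of `π` if `π⁻¹ i < i > π i`. -/
def IsCyclePeak {n : ℕ} (π : Equiv.Perm (Idx n)) (i : Idx n) : Prop :=
  π.symm i < i ∧ π i < i

/-- `i` is a cycle valley of `π` if `π⁻¹ i > i < π i`. -/
def IsCycleValley {n : ℕ} (π : Equiv.Perm (Idx n)) (i : Idx n) : Prop :=
  i < π.symm i ∧ i < π i

/-- Cycle-alternating signed permutations of size `n`: every index is a cycle peak or
a cycle valley. -/
def CycleAlternating (n : ℕ) : Type :=
  {π : SignedPerm n // ∀ i, IsCyclePeak π.1 i ∨ IsCycleValley π.1 i}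

/-- The number of `i ∈ {1, …, n}` with `π i < 0`. -/
noncomputable def SignedPerm.neg {n : ℕ} (π : SignedPerm n) : ℕ :=
  (Finset.univ.filter fun i : Idx n => 0 < i.1 ∧ (π.1 i).1 < 0).card

/-- The number of crossings of `π`: pairs `(i, j)` with `i < j < π i < π j`. -/
noncomputable def CycleAlternating.cro {n : ℕ} (π : CycleAlternating n) : ℕ :=
  (Finset.univ.filter fun x : Idx n × Idx n =>
    x.1 < x.2 ∧ x.2 < π.1.1 x.1 ∧ π.1.1 x.1 < π.1.1 x.2).card

/-- A lattice path with weighted steps: the list of its steps, in order. The pair `(s, i)` is a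
step of type `s` (`DyckStep.U` is up, `DyckStep.D` is down) with weight `q ^ i`. -/
abbrev WeightedPath : Type := List (DyckStep × ℕ)

/-- The path, started at height `h`, never goes below height `0`; each up step from `k` to `k + 1`
has weight `q ^ i` with `i ∈ {0, …, k + 1}`, and each down step from `k + 1` to `k` has weight
`q ^ i` with `i ∈ {0, …, k}`. -/
def IsDyckPrefixFrom : ℕ → WeightedPath → Prop
  | _, [] => True
  | h, (DyckStep.U, i) :: p => i ≤ h + 1 ∧ IsDyckPrefixFrom (h + 1) p
  | 0, (DyckStep.D, _) :: _ => False
  | h + 1, (DyckStep.D, i) :: p => i ≤ h ∧ IsDyckPrefixFrom h p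

/-- No up step of the path, started at height `h`, goes from a height `k` to `k + 1` with the
maximal weight `q ^ (k + 1)`. (The truncation in `h - 1` is never met by Dyck prefixes.) -/
def NoMaximalUpFrom : ℕ → WeightedPath → Prop
  | _, [] => True
  | h, (DyckStep.U, i) :: p => i ≠ h + 1 ∧ NoMaximalUpFrom (h + 1) p
  | h, (DyckStep.D, _) :: p => NoMaximalUpFrom (h - 1) p

/-- The set of weighted Dyck prefixes of length `n`. -/
def weightedDyckPrefixes (n : ℕ) : Set WeightedPath :=
  {p | p.length = n ∧ IsDyckPrefixFrom 0 p}

/-- The set of weighted Dyck prefixes of length `n` that have no up step starting at a height `h`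
with the maximal weight `q ^ (h + 1)`. -/
def restrictedDyckPrefixes (n : ℕ) : Set WeightedPath :=
  {p | p ∈ weightedDyckPrefixes n ∧ NoMaximalUpFrom 0 p}

/-- The final height of a path that starts at height `0`. -/
def finalHeight (p : WeightedPath) : ℤ :=
  ((p.map Prod.fst).count DyckStep.U : ℤ) - ((p.map Prod.fst).count DyckStep.D : ℤ)

/-- The exponent of `q` in the total weight (the product of the weights of the steps). -/
def totalWeight (p : WeightedPath) : ℕ := (p.map Prod.snd).sum

end CycAlt

/-! If `π` is cycle-alternating, it exchanges valleys and peaks, and `x` is a valley exactly when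
`-x` is a peak. By the sign symmetry, `π` is therefore determined by the arcs from each valley up to
its image, a peak: a matching of openers with later closers, in which opener and closer are
exchanged by negation. Scan the line from left to right. A closer `p` picks one of the openers still
unmatched, and the number of these to the right of its pick is the number of crossings whose first
arc ends at `p`. Such numbers `W p` encode the matching uniquely, and every choice with `W p` below
the height before `p` occurs (`IsClosing.eqOn`, `exists_isClosing`). Exactly one of `x < 0` and `-x`
is a closer. For a down step it is `x`. For an up step from `h` it is `-x`, and there the height is
again `h + 1` (`height_neg`), so the weight is at most `h`: exactly the non-maximal up weights. The
height at `0` counts the arcs from negative to positive, which is `neg`. -/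

namespace CycAlt

/-! ### Matchings of openers with closers, encoded by weights -/

section Closing

variable {α : Type*} [LinearOrder α]

theorem exists_mem_card_filter_gt_eq (s : Finset α) :
    ∀ k < s.card, ∃ a ∈ s, (s.filter (a < ·)).card = k := by
  induction s using Finset.induction_on_min with
  | empty => simp
  | insert a s ha ih =>
    intro k hk
    have has : a ∉ s := fun h => lt_irrefl _ (ha a h)
    rw [Finset.card_insert_of_notMem has] at hk
    rcases Nat.lt_succ_iff_lt_or_eq.mp hk with hk | rfl
    · obtain ⟨b, hb, hbk⟩ := ih k hk
      refine ⟨b, Finset.mem_insert_of_mem hb, ?_⟩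
      rw [Finset.filter_insert, if_neg (ha b hb).not_gt, hbk]
    · refine ⟨a, Finset.mem_insert_self _ _, ?_⟩
      rw [Finset.filter_insert, if_neg (lt_irrefl a), Finset.filter_true_of_mem ha]

/-- The contribution of a position to the height: `1` for an opener, `-1` for a closer. -/
def sgn (V : Finset α) (y : α) : ℤ := if y ∈ V then 1 else -1

theorem sum_sgn (V s : Finset α) : ∑ y ∈ s, sgn V y =
    ((s.filter (· ∈ V)).card : ℤ) - (s.filter (· ∉ V)).card := by
  simp only [sgn, Finset.sum_ite, Finset.sum_const, nsmul_eq_mul]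
  ring

variable [Fintype α]

/-- The openers to the left of `p` that are not matched by `f` to a closer to the left of `p`. -/
def available (V : Finset α) (f : α → α) (p : α) : Finset α :=
  Finset.univ.filter fun j => j ∈ V ∧ j < p ∧ ∀ r < p, r ∉ V → f r ≠ j

/-- `f` matches each closer `p ∉ V` to an available opener, in such a way that exactly `W p`
available openers lie further to the right. -/
def IsClosing (V : Finset α) (W : α → ℕ) (f : α → α) : Prop :=
  ∀ p ∉ V, f p ∈ available V f p ∧ ((available V f p).filter (f p < ·)).card = W p

theorem available_congr {V : Finset α} {f g : α → α} {p : α}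
    (h : ∀ r < p, r ∉ V → f r = g r) : available V f p = available V g p := by
  ext j
  simp only [available, Finset.mem_filter, Finset.mem_univ, true_and]
  refine and_congr_right fun _ => and_congr_right fun _ => ?_
  exact forall_congr' fun r => forall_congr' fun hr => forall_congr' fun hV => by rw [h r hr hV]

/-- The available set at `p` depends only on earlier choices, and an element of a finite chain is
determined by how many elements lie above it. -/
theorem IsClosing.eqOn {V : Finset α} {W : α → ℕ} {f g : α → α}
    (hf : IsClosing V W f) (hg : IsClosing V W g) : ∀ p ∉ V, f p = g p := by
  have key : ∀ (s : Finset α) (a b : α), b ∈ s → a < b →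
      (s.filter (a < ·)).card ≠ (s.filter (b < ·)).card := by
    intro s a b hb hab
    refine (Finset.card_lt_card ⟨fun x hx => ?_, fun h => ?_⟩).ne'
    · simp only [Finset.mem_filter] at hx ⊢
      exact ⟨hx.1, hab.trans hx.2⟩
    · have := h (Finset.mem_filter.mpr ⟨hb, hab⟩)
      simp at this
  intro p
  induction p using WellFoundedLT.induction with
  | ind p ih =>
    intro hp
    have hA := available_congr ih
    obtain ⟨hf1, hf2⟩ := hf p hp
    obtain ⟨hg1, hg2⟩ := hg p hp
    rw [hA] at hf1 hf2
    rcases lt_trichotomy (f p) (g p) with h | h | h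
    · exact absurd (hf2.trans hg2.symm) (key _ _ _ hg1 h)
    · exact h
    · exact absurd (hg2.trans hf2.symm) (key _ _ _ hf1 h)

/-- Distinct closers use up distinct openers. Only the closers before `p` are constrained, so that
this applies while a matching is still being built. -/
theorem sum_sgn_eq_card_available {V : Finset α} {f : α → α} {p : α}
    (h : ∀ r < p, r ∉ V → f r ∈ available V f r) :
    ∑ y with y < p, sgn V y = (available V f p).card := by
  have hinj : Set.InjOn f (Finset.univ.filter fun r => r < p ∧ r ∉ V : Finset α) := by
    intro r hr s hs hrs
    simp only [Finset.coe_filter, Finset.mem_univ, true_and, Set.mem_ofPred_eq] at hr hs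
    have h1 := h r hr.1 hr.2
    have h2 := h s hs.1 hs.2
    simp only [available, Finset.mem_filter, Finset.mem_univ, true_and] at h1 h2
    rcases lt_trichotomy r s with hlt | heq | hlt
    · exact absurd hrs (h2.2.2 r hlt hr.2)
    · exact heq
    · exact absurd hrs.symm (h1.2.2 s hlt hs.2)
  have hav : available V f p = (Finset.univ.filter fun j => j < p ∧ j ∈ V) \
      (Finset.univ.filter fun r => r < p ∧ r ∉ V).image f := by
    ext j
    simp only [available, Finset.mem_filter, Finset.mem_univ, true_and, Finset.mem_sdiff,
      Finset.mem_image, not_exists, not_and]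
    tauto
  have hsub : (Finset.univ.filter fun r => r < p ∧ r ∉ V).image f ⊆
      Finset.univ.filter fun j => j < p ∧ j ∈ V := by
    intro j hj
    simp only [Finset.mem_image, Finset.mem_filter, Finset.mem_univ, true_and] at hj ⊢
    obtain ⟨r, hr, rfl⟩ := hj
    have h1 := h r hr.1 hr.2
    simp only [available, Finset.mem_filter, Finset.mem_univ, true_and] at h1
    exact ⟨h1.2.1.trans hr.1, h1.1⟩
  rw [hav, Finset.cast_card_sdiff hsub, Finset.card_image_of_injOn hinj]
  rw [sum_sgn, Finset.filter_filter, Finset.filter_filter]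

theorem exists_isClosing {V : Finset α} {W : α → ℕ}
    (hW : ∀ p ∉ V, (W p : ℤ) < ∑ y with y < p, sgn V y) : ∃ f, IsClosing V W f := by
  classical
  -- The default `d` makes the choice total, so the recursion need not carry a proof that enough
  -- openers are available.
  have hpick : ∃ pick : Finset α → ℕ → α → α, ∀ s k d, k < s.card →
      pick s k d ∈ s ∧ (s.filter (pick s k d < ·)).card = k := by
    have : ∀ (s : Finset α) (k : ℕ) (d : α), ∃ a, k < s.card →
        a ∈ s ∧ (s.filter (a < ·)).card = k := by
      intro s k d
      by_cases hk : k < s.card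
      · obtain ⟨a, ha⟩ := exists_mem_card_filter_gt_eq s k hk
        exact ⟨a, fun _ => ha⟩
      · exact ⟨d, fun h => absurd h hk⟩
    choose pick h using this
    exact ⟨pick, h⟩
  obtain ⟨pick, hpick⟩ := hpick
  -- The dummy value `r` is harmless: `available` at `p` only looks at positions before `p`.
  let F : (p : α) → ((y : α) → y < p → α) → α := fun p G =>
    pick (available V (fun r => if h : r < p then G r h else r) p) (W p) p
  let f : α → α := IsWellFounded.fix (· < ·) F
  have hf : ∀ p, f p = pick (available V f p) (W p) p := by
    intro p
    have h1 : f p = F p fun y _ => f y := IsWellFounded.fix_eq (· < ·) F p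
    rw [h1]
    simp only [F]
    rw [available_congr (g := f)]
    intro r hr _
    simp [hr]
  have main : ∀ p ∉ V, f p ∈ available V f p ∧
      ((available V f p).filter (f p < ·)).card = W p := by
    intro p
    induction p using WellFoundedLT.induction with
    | ind p ih =>
      intro hp
      have hc := hW p hp
      rw [sum_sgn_eq_card_available fun r hr hV => (ih r hr hV).1] at hc
      have := hpick (available V f p) (W p) p (by exact_mod_cast hc)
      rwa [← hf] at this
  exact ⟨f, main⟩

end Closing

/-! ### Heights and weight bounds along a path -/

section Paths

theorem finalHeight_cons (s : DyckStep × ℕ) (p : WeightedPath) :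
    finalHeight (s :: p) = (if s.1 = DyckStep.U then 1 else -1) + finalHeight p := by
  obtain ⟨s, w⟩ := s
  cases s <;> simp [finalHeight] <;> ring

theorem finalHeight_take_succ (p : WeightedPath) (i : ℕ) (hi : i < p.length) :
    finalHeight (p.take (i + 1)) =
      finalHeight (p.take i) + (if p[i].1 = DyckStep.U then 1 else -1) := by
  induction p generalizing i with
  | nil => simp at hi
  | cons s p ih =>
    cases i with
    | zero =>
      simp only [zero_add, List.take_succ_cons, finalHeight_cons, List.take_zero,
        List.getElem_cons_zero]
      ring
    | succ i =>
      simp only [List.take_succ_cons, finalHeight_cons, List.getElem_cons_succ]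
      rw [ih i (by simpa using hi)]
      ring

/-- Excluding the maximal up weight leaves `i < k + 1` for an up step from `k`, and a down step from
`k` has `i < k`. The latter also forces `k > 0`, so it encodes that the path stays nonnegative. -/
theorem isDyckPrefixFrom_and_noMaximalUpFrom_iff (h : ℕ) (p : WeightedPath) :
    IsDyckPrefixFrom h p ∧ NoMaximalUpFrom h p ↔
      ∀ (i : ℕ) (hi : i < p.length), (p[i].2 : ℤ) <
        h + finalHeight (p.take i) + (if p[i].1 = DyckStep.U then 1 else 0) := by
  induction p generalizing h with
  | nil => simp [IsDyckPrefixFrom, NoMaximalUpFrom]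
  | cons s p ih =>
    have hsplit : ∀ Q : ∀ i, i < (s :: p).length → Prop, (∀ i hi, Q i hi) ↔
        Q 0 (by simp) ∧ ∀ i (hi : i < p.length), Q (i + 1) (by simpa using hi) := by
      intro Q
      refine ⟨fun H => ⟨H _ _, fun i hi => H _ _⟩, fun H i hi => ?_⟩
      cases i with
      | zero => exact H.1
      | succ i => exact H.2 i (by simpa using hi)
    rw [hsplit]
    simp only [List.getElem_cons_zero, List.getElem_cons_succ, List.take_zero,
      List.take_succ_cons, finalHeight_cons]
    have h0 : finalHeight [] = 0 := by simp [finalHeight]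
    obtain ⟨s, w⟩ := s
    cases s with
    | U =>
      have := ih (h + 1)
      simp only [IsDyckPrefixFrom, NoMaximalUpFrom, h0, if_true]
      push_cast [add_assoc] at this
      simp only [add_assoc]
      rw [← this]
      constructor
      · rintro ⟨⟨h1, h2⟩, h3, h4⟩
        exact ⟨by omega, h2, h4⟩
      · rintro ⟨h1, h2, h4⟩
        exact ⟨⟨by omega, h2⟩, by omega, h4⟩
    | D =>
      cases h with
      | zero =>
        simp only [IsDyckPrefixFrom, h0]
        simp
      | succ h =>
        have := ih h
        simp only [IsDyckPrefixFrom, NoMaximalUpFrom, h0, Nat.add_sub_cancel]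
        simp only [reduceCtorEq, if_false]
        push_cast
        have e : ∀ x : ℤ, (h : ℤ) + 1 + (-1 + x) = h + x := fun x => by ring
        simp only [e]
        rw [← this]
        constructor
        · rintro ⟨⟨h1, h2⟩, h4⟩
          exact ⟨by omega, h2, h4⟩
        · rintro ⟨h1, h2, h4⟩
          exact ⟨⟨by omega, h2⟩, h4⟩

end Paths

/-! ### Symmetric positions and their heights -/

namespace Idx

variable {n : ℕ}

theorem opp_val (x : Idx n) : x.opp.1 = -x.1 := rfl

@[simp] theorem opp_opp (x : Idx n) : x.opp.opp = x := Subtype.ext (neg_neg x.1)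

theorem opp_injective : Function.Injective (opp : Idx n → Idx n) :=
  Function.LeftInverse.injective opp_opp

theorem opp_lt_opp {x y : Idx n} : x.opp < y.opp ↔ y < x := by
  rw [← Subtype.coe_lt_coe, ← Subtype.coe_lt_coe, opp_val, opp_val, neg_lt_neg_iff]

theorem val_ne_zero (x : Idx n) : x.1 ≠ 0 := (Finset.mem_erase.mp x.2).1

theorem val_bounds (x : Idx n) : -(n : ℤ) ≤ x.1 ∧ x.1 ≤ n :=
  Finset.mem_Icc.mp (Finset.mem_erase.mp x.2).2

/-- The `i`-th position from the left. -/
def pos (i : Fin n) : Idx n :=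
  ⟨i - n, by
    have := i.2
    simp only [Finset.mem_erase, Finset.mem_Icc, ne_eq]
    omega⟩

theorem pos_val (i : Fin n) : (pos i).1 = i - n := rfl

theorem exists_pos_eq {x : Idx n} (hx : x.1 < 0) : ∃ i, pos i = x := by
  have := x.val_bounds
  refine ⟨⟨(x.1 + n).toNat, by omega⟩, Subtype.ext ?_⟩
  simp only [pos]
  omega

theorem pos_injective : Function.Injective (pos : Fin n → Idx n) := by
  intro i j h
  have := congrArg Subtype.val h
  simp only [pos] at this
  exact Fin.ext (by omega)

theorem exists_pos (x : Idx n) : ∃ i, x = pos i ∨ x = (pos i).opp := by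
  rcases lt_or_gt_of_ne x.val_ne_zero with h | h
  · obtain ⟨i, rfl⟩ := exists_pos_eq h
    exact ⟨i, Or.inl rfl⟩
  · obtain ⟨i, hi⟩ := exists_pos_eq (x := x.opp) (by rw [opp_val]; omega)
    exact ⟨i, Or.inr (by rw [hi, opp_opp])⟩

theorem sum_eq_sum_pos (F : Idx n → ℕ) : ∑ x, F x = ∑ i, (F (pos i) + F (pos i).opp) := by
  have h1 : ∑ x : Idx n with x.1 < 0, F x = ∑ i, F (pos i) := by
    symm
    refine Finset.sum_bij (fun i _ => pos i) ?_ (fun _ _ _ _ h => pos_injective h) ?_ (by simp)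
    · intro i _
      have := i.2
      simp only [Finset.mem_filter, Finset.mem_univ, true_and, pos_val]
      omega
    · intro x hx
      obtain ⟨i, hi⟩ := exists_pos_eq (Finset.mem_filter.mp hx).2
      exact ⟨i, Finset.mem_univ _, hi⟩
  have h2 : ∑ x : Idx n with ¬ x.1 < 0, F x = ∑ i, F (pos i).opp := by
    symm
    refine Finset.sum_bij (fun i _ => (pos i).opp) ?_
      (fun _ _ _ _ h => pos_injective (opp_injective h)) ?_ (by simp)
    · intro i _
      have := i.2
      simp only [Finset.mem_filter, Finset.mem_univ, true_and, pos_val, opp_val]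
      omega
    · intro x hx
      have h0 := x.val_ne_zero
      have hx := (Finset.mem_filter.mp hx).2
      obtain ⟨i, hi⟩ := exists_pos_eq (x := x.opp) (by rw [opp_val]; omega)
      exact ⟨i, Finset.mem_univ _, by rw [hi, opp_opp]⟩
  rw [← Finset.sum_filter_add_sum_filter_not _ (fun x : Idx n => x.1 < 0), h1, h2,
    Finset.sum_add_distrib]

/-- The height of the path with openers `V` just to the left of `t`. -/
noncomputable def height (V : Finset (Idx n)) (t : ℤ) : ℤ := ∑ y : Idx n with y.1 < t, sgn V y

theorem height_succ (V : Finset (Idx n)) (x : Idx n) :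
    height V (x.1 + 1) = height V x.1 + sgn V x := by
  have : (Finset.univ.filter fun y : Idx n => y.1 < x.1 + 1) =
      insert x (Finset.univ.filter fun y : Idx n => y.1 < x.1) := by
    ext y
    simp only [Finset.mem_filter, Finset.mem_univ, true_and, Finset.mem_insert, Subtype.ext_iff]
    omega
  rw [height, this, Finset.sum_insert (by simp), add_comm, height]

theorem height_neg {V : Finset (Idx n)} (hV : ∀ x, x.opp ∈ V ↔ x ∉ V) {x : Idx n}
    (hx : x.1 < 0) : height V (-x.1) = height V (x.1 + 1) := by
  have hsplit : height V (-x.1) = height V (x.1 + 1) +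
      ∑ y : Idx n with x.1 < y.1 ∧ y.1 < -x.1, sgn V y := by
    rw [height, height, ← Finset.sum_union]
    · congr 1
      ext y
      simp only [Finset.mem_filter, Finset.mem_univ, true_and, Finset.mem_union]
      omega
    · refine Finset.disjoint_left.mpr fun y => ?_
      simp only [Finset.mem_filter, Finset.mem_univ, true_and]
      omega
  -- Negation preserves this interval and exchanges openers with closers, so the sum is its own
  -- negative.
  have hzero : ∑ y : Idx n with x.1 < y.1 ∧ y.1 < -x.1, sgn V y =
      -∑ y : Idx n with x.1 < y.1 ∧ y.1 < -x.1, sgn V y := by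
    rw [← Finset.sum_neg_distrib]
    refine Finset.sum_bij (fun y _ => y.opp) ?_ (fun _ _ _ _ h => opp_injective h) ?_ ?_
    · intro y hy
      simp only [Finset.mem_filter, Finset.mem_univ, true_and, opp_val] at hy ⊢
      omega
    · intro y hy
      refine ⟨y.opp, ?_, opp_opp y⟩
      simp only [Finset.mem_filter, Finset.mem_univ, true_and, opp_val] at hy ⊢
      omega
    · intro y _
      by_cases h : y ∈ V <;> simp [sgn, hV, h]
  omega

end Idx

/-- The chosen opener is available but not to the right of itself, so the inequality is strict. -/
theorem IsClosing.lt_sum_sgn {α : Type*} [LinearOrder α] [Fintype α] {V : Finset α} {W : α → ℕ}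
    {f : α → α} (hf : IsClosing V W f) {p : α} (hp : p ∉ V) :
    (W p : ℤ) < ∑ y with y < p, sgn V y := by
  rw [sum_sgn_eq_card_available fun r _ hr => (hf r hr).1, ← (hf p hp).2]
  refine Int.ofNat_lt.mpr (Finset.card_lt_card ⟨Finset.filter_subset _ _, fun h => ?_⟩)
  have := h (hf p hp).1
  simp at this

/-! ### Path conditions as bounds at the closers -/

namespace Idx

variable {n : ℕ}

theorem sum_lt_sgn_eq_height (V : Finset (Idx n)) (p : Idx n) :
    ∑ y with y < p, sgn V y = height V p.1 := rfl

/-- The number `i` such that `x` is the `i`-th position from the left or its opposite. -/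
def index (x : Idx n) : Fin n :=
  ⟨n - x.1.natAbs, by
    have := x.val_ne_zero
    have := x.val_bounds
    omega⟩

theorem index_opp (x : Idx n) : x.opp.index = x.index := by
  simp [index, opp_val]

theorem index_pos (i : Fin n) : (pos i).index = i := by
  have := i.2
  ext
  simp only [index, pos_val]
  omega

theorem finalHeight_take_eq_height {V : Finset (Idx n)} {p : WeightedPath} (hp : p.length = n)
    (hV : ∀ i : Fin n, pos i ∈ V ↔ p[i].1 = DyckStep.U) :
    ∀ i ≤ n, finalHeight (p.take i) = height V (i - n) := by
  intro i
  induction i with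
  | zero =>
    intro _
    have : (Finset.univ.filter fun y : Idx n => y.1 < ((0 : ℕ) : ℤ) - n) = ∅ := by
      refine Finset.filter_eq_empty_iff.mpr fun y _ => ?_
      have := y.val_bounds
      push_cast
      omega
    rw [height, this]
    simp [finalHeight]
  | succ i ih =>
    intro hi
    have h1 := height_succ V (pos ⟨i, hi⟩)
    have h2 := hV ⟨i, hi⟩
    simp only [pos_val] at h1
    rw [finalHeight_take_succ p i (by omega), ih (by omega), Nat.cast_succ,
      show (i : ℤ) + 1 - n = i - n + 1 by ring, h1, sgn]
    simp only [h2]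
    rfl

/-- A down step is itself a closer. An up step at `x` is tested at the closer `-x`, where the height
equals the height just after the step; this accounts for the extra `1` in the bound for up steps. -/
theorem mem_restrictedDyckPrefixes_iff {V : Finset (Idx n)} (hV : ∀ x, x.opp ∈ V ↔ x ∉ V)
    {p : WeightedPath} (hp : p.length = n)
    (hpV : ∀ i : Fin n, pos i ∈ V ↔ p[i].1 = DyckStep.U) :
    p ∈ restrictedDyckPrefixes n ↔ ∀ x ∉ V, (p[x.index].2 : ℤ) < height V x.1 := by
  have h1 : p ∈ restrictedDyckPrefixes n ↔ IsDyckPrefixFrom 0 p ∧ NoMaximalUpFrom 0 p := by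
    simp [restrictedDyckPrefixes, weightedDyckPrefixes, hp]
  have hneg : ∀ i : Fin n, (pos i).1 < 0 := fun i => by
    have := i.2
    rw [pos_val]
    omega
  rw [h1, isDyckPrefixFrom_and_noMaximalUpFrom_iff]
  constructor
  · intro h x hx
    obtain ⟨i, rfl | rfl⟩ := exists_pos x
    · have h2 := h i (by omega)
      rw [finalHeight_take_eq_height hp hpV i i.2.le] at h2
      rw [hpV] at hx
      simp only [index_pos, pos_val, Fin.getElem_fin] at hx ⊢
      rw [if_neg hx] at h2
      simpa using h2
    · have h2 := h i (by omega)
      rw [finalHeight_take_eq_height hp hpV i i.2.le] at h2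
      rw [hV, not_not] at hx
      rw [opp_val, height_neg hV (hneg i), height_succ, sgn, if_pos hx, pos_val]
      rw [hpV] at hx
      simp only [index_opp, index_pos, Fin.getElem_fin] at hx ⊢
      rw [if_pos hx] at h2
      simpa using h2
  · intro h i hi
    obtain ⟨j, rfl⟩ : ∃ j : Fin n, (j : ℕ) = i := ⟨⟨i, by omega⟩, rfl⟩
    rw [finalHeight_take_eq_height hp hpV j j.2.le]
    by_cases hj : pos j ∈ V
    · have h2 := h (pos j).opp (by rwa [hV, not_not])
      rw [opp_val, height_neg hV (hneg j), height_succ, sgn, if_pos hj, pos_val] at h2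
      rw [hpV] at hj
      simp only [index_opp, index_pos, Fin.getElem_fin] at hj h2
      rw [if_pos hj]
      simpa using h2
    · have h2 := h (pos j) hj
      rw [hpV] at hj
      simp only [index_pos, pos_val, Fin.getElem_fin] at hj h2
      rw [if_neg hj]
      simpa using h2

end Idx

/-! ### From permutations to paths -/

namespace CycleAlternating

open Idx

variable {n : ℕ}

/-- The underlying permutation. -/
def perm (π : CycleAlternating n) : Equiv.Perm (Idx n) := π.1.1

theorem perm_opp (π : CycleAlternating n) (x : Idx n) : π.perm x.opp = (π.perm x).opp := π.1.2 x

theorem perm_symm_opp (π : CycleAlternating n) (x : Idx n) :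
    π.perm.symm x.opp = (π.perm.symm x).opp := by
  rw [Equiv.symm_apply_eq, perm_opp, Equiv.apply_symm_apply]

/-- The cycle valleys. -/
noncomputable def valleys (π : CycleAlternating n) : Finset (Idx n) := Finset.univ.filter fun x => x < π.perm x

theorem mem_valleys {π : CycleAlternating n} {x : Idx n} : x ∈ π.valleys ↔ x < π.perm x := by
  simp [valleys]

theorem mem_valleys_iff_lt_symm {π : CycleAlternating n} {x : Idx n} :
    x ∈ π.valleys ↔ x < π.perm.symm x := by
  rw [mem_valleys]
  rcases π.2 x with h | h
  · exact iff_of_false h.2.not_gt h.1.not_gt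
  · exact iff_of_true h.2 h.1

theorem notMem_valleys {π : CycleAlternating n} {x : Idx n} : x ∉ π.valleys ↔ π.perm x < x := by
  rw [mem_valleys]
  rcases π.2 x with h | h
  · exact iff_of_true h.2.not_gt h.2
  · exact iff_of_false (not_not.mpr h.2) h.2.not_gt

theorem notMem_valleys_iff_symm_lt {π : CycleAlternating n} {x : Idx n} :
    x ∉ π.valleys ↔ π.perm.symm x < x := by
  rw [mem_valleys_iff_lt_symm]
  rcases π.2 x with h | h
  · exact iff_of_true h.1.not_gt h.1
  · exact iff_of_false (not_not.mpr h.1) h.1.not_gt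

theorem opp_mem_valleys (π : CycleAlternating n) (x : Idx n) :
    x.opp ∈ π.valleys ↔ x ∉ π.valleys := by
  rw [mem_valleys, notMem_valleys, perm_opp, opp_lt_opp]

/-- The number of crossings whose first arc ends at `p`. -/
noncomputable def crossingsAt (π : CycleAlternating n) (p : Idx n) : ℕ :=
  (Finset.univ.filter fun j => π.perm.symm p < j ∧ j < p ∧ p < π.perm j).card

theorem crossingsAt_of_mem {π : CycleAlternating n} {p : Idx n} (hp : p ∈ π.valleys) :
    π.crossingsAt p = 0 := by
  rw [mem_valleys_iff_lt_symm] at hp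
  refine Finset.card_eq_zero.mpr (Finset.filter_eq_empty_iff.mpr fun j _ h => ?_)
  exact lt_asymm hp (h.1.trans h.2.1)

theorem sum_crossingsAt (π : CycleAlternating n) : ∑ p, π.crossingsAt p = π.cro := by
  rw [cro, Finset.card_eq_sum_card_fiberwise (f := fun x : Idx n × Idx n => π.perm x.1)
    (t := Finset.univ) (by simp)]
  refine Finset.sum_congr rfl fun p _ => ?_
  refine Finset.card_bij (fun j _ => (π.perm.symm p, j)) ?_ ?_ ?_
  · intro j hj
    simp only [Finset.mem_filter, Finset.mem_univ, true_and, Equiv.apply_symm_apply, and_true]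
      at hj ⊢
    have e : π.1.1 (π.perm.symm p) = p := π.perm.apply_symm_apply p
    rw [e]
    exact hj
  · intro j _ k _ h
    exact (Prod.ext_iff.mp h).2
  · rintro ⟨i, j⟩ h
    simp only [Finset.mem_filter, Finset.mem_univ, true_and] at h
    obtain ⟨h, rfl⟩ := h
    refine ⟨j, ?_, by simp⟩
    simp only [Finset.mem_filter, Finset.mem_univ, true_and, Equiv.symm_apply_apply]
    exact h

/-- These are the arcs still open just before `p`; the weak inequality keeps the arc that ends at
`p`. -/
theorem available_eq (π : CycleAlternating n) (p : Idx n) :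
    available π.valleys π.perm.symm p = Finset.univ.filter fun j => j < p ∧ p ≤ π.perm j := by
  ext j
  simp only [available, Finset.mem_filter, Finset.mem_univ, true_and]
  constructor
  · rintro ⟨hj, hjp, h⟩
    refine ⟨hjp, not_lt.mp fun hlt => h _ hlt ?_ (Equiv.symm_apply_apply _ _)⟩
    rw [notMem_valleys_iff_symm_lt, Equiv.symm_apply_apply]
    exact mem_valleys.mp hj
  · rintro ⟨hjp, hp⟩
    refine ⟨mem_valleys.mpr (hjp.trans_le hp), hjp, ?_⟩
    rintro r hr - rfl
    rw [Equiv.apply_symm_apply] at hp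
    exact hp.not_gt hr

theorem isClosing (π : CycleAlternating n) :
    IsClosing π.valleys π.crossingsAt π.perm.symm := by
  intro p hp
  rw [available_eq]
  refine ⟨?_, ?_⟩
  · simpa using notMem_valleys_iff_symm_lt.mp hp
  · rw [crossingsAt, Finset.filter_filter]
    congr 1
    ext j
    simp only [Finset.mem_filter, Finset.mem_univ, true_and]
    constructor
    · rintro ⟨⟨h1, h2⟩, h3⟩
      refine ⟨h3, h1, lt_of_le_of_ne h2 ?_⟩
      rintro rfl
      simp at h3
    · rintro ⟨h1, h2, h3⟩
      exact ⟨⟨h2, h3.le⟩, h1⟩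

theorem neg_eq_height (π : CycleAlternating n) : (π.1.neg : ℤ) = height π.valleys 0 := by
  have hneg : π.1.neg = (Finset.univ.filter fun x : Idx n => x.1 < 0 ∧ 0 < (π.perm x).1).card := by
    refine Finset.card_bij (fun x _ => x.opp) ?_ (fun _ _ _ _ h => opp_injective h) ?_
    · intro x hx
      simp only [Finset.mem_filter, Finset.mem_univ, true_and, perm_opp, opp_val] at hx ⊢
      have : (π.perm x).1 < 0 := hx.2
      omega
    · intro x hx
      refine ⟨x.opp, ?_, opp_opp x⟩
      simp only [Finset.mem_filter, Finset.mem_univ, true_and, opp_val] at hx ⊢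
      have : (π.1.1 x.opp).1 = -(π.perm x).1 := congrArg Subtype.val (π.perm_opp x)
      omega
  -- A negative peak is matched to a smaller, hence negative, valley. Such pairs cancel in the
  -- height at `0`.
  have hpeak : (Finset.univ.filter fun x : Idx n => x.1 < 0 ∧ x ∉ π.valleys).card =
      (Finset.univ.filter fun x : Idx n => (x.1 < 0 ∧ x ∈ π.valleys) ∧ (π.perm x).1 < 0).card := by
    refine Finset.card_bij (fun x _ => π.perm.symm x) ?_
      (fun _ _ _ _ h => π.perm.symm.injective h) ?_
    · intro x hx
      rw [Finset.mem_filter, notMem_valleys_iff_symm_lt] at hx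
      simp only [Finset.mem_filter, Finset.mem_univ, true_and, mem_valleys,
        Equiv.apply_symm_apply] at hx ⊢
      have : (π.perm.symm x).1 < x.1 := hx.2
      exact ⟨⟨by omega, hx.2⟩, hx.1⟩
    · intro x hx
      refine ⟨π.perm x, ?_, Equiv.symm_apply_apply _ _⟩
      rw [Finset.mem_filter, notMem_valleys_iff_symm_lt]
      simp only [Finset.mem_filter, Finset.mem_univ, true_and, mem_valleys,
        Equiv.symm_apply_apply] at hx ⊢
      exact ⟨hx.2, hx.1.2⟩
  have hsplit := Finset.card_filter_add_card_filter_not (s := Finset.univ.filter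
    fun x : Idx n => x.1 < 0 ∧ x ∈ π.valleys) (fun x => (π.perm x).1 < 0)
  rw [Finset.filter_filter, Finset.filter_filter, ← hpeak] at hsplit
  have hlast : (Finset.univ.filter fun x : Idx n => (x.1 < 0 ∧ x ∈ π.valleys) ∧
      ¬ (π.perm x).1 < 0) = Finset.univ.filter fun x : Idx n => x.1 < 0 ∧ 0 < (π.perm x).1 := by
    ext x
    have h0 := (π.perm x).val_ne_zero
    simp only [Finset.mem_filter, Finset.mem_univ, true_and, mem_valleys]
    rw [← Subtype.coe_lt_coe]
    omega
  rw [hlast, ← hneg] at hsplit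
  have hheight : height π.valleys 0 =
      ((Finset.univ.filter fun x : Idx n => x.1 < 0 ∧ x ∈ π.valleys).card : ℤ) -
        (Finset.univ.filter fun x : Idx n => x.1 < 0 ∧ x ∉ π.valleys).card := by
    rw [height, sum_sgn, Finset.filter_filter, Finset.filter_filter]
    congr!
  omega

/-- The weighted path of `π`: reading the negative positions from the left, valleys give up steps
and peaks give down steps; the weight counts the crossings at the peak among `x` and `-x`. -/
noncomputable def path (π : CycleAlternating n) : WeightedPath :=
  List.ofFn fun i : Fin n => (if pos i ∈ π.valleys then DyckStep.U else DyckStep.D,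
    π.crossingsAt (pos i) + π.crossingsAt (pos i).opp)

theorem length_path (π : CycleAlternating n) : π.path.length = n := List.length_ofFn

theorem path_getElem (π : CycleAlternating n) (i : ℕ) (hi : i < π.path.length) :
    π.path[i] = (if pos ⟨i, π.length_path ▸ hi⟩ ∈ π.valleys then DyckStep.U else DyckStep.D,
      π.crossingsAt (pos ⟨i, π.length_path ▸ hi⟩) +
        π.crossingsAt (pos ⟨i, π.length_path ▸ hi⟩).opp) := by
  simp [path]

theorem pos_mem_valleys_iff (π : CycleAlternating n) (i : Fin n) :
    pos i ∈ π.valleys ↔ (π.path[i]'(by rw [length_path]; exact i.2)).1 = DyckStep.U := by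
  rw [Fin.getElem_fin, path_getElem]
  by_cases h : pos i ∈ π.valleys <;> simp [h]

theorem path_index_snd (π : CycleAlternating n) {x : Idx n} (hx : x ∉ π.valleys) :
    (π.path[x.index]'(by rw [length_path]; exact x.index.2)).2 = π.crossingsAt x := by
  rw [Fin.getElem_fin, path_getElem]
  obtain ⟨i, rfl | rfl⟩ := exists_pos x
  · simp [index_pos, crossingsAt_of_mem ((π.opp_mem_valleys _).mpr hx)]
  · rw [opp_mem_valleys, not_not] at hx
    simp [index_opp, index_pos, crossingsAt_of_mem hx]

theorem path_mem (π : CycleAlternating n) : π.path ∈ restrictedDyckPrefixes n := by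
  rw [mem_restrictedDyckPrefixes_iff π.opp_mem_valleys π.length_path π.pos_mem_valleys_iff]
  intro x hx
  rw [path_index_snd π hx, ← sum_lt_sgn_eq_height]
  exact π.isClosing.lt_sum_sgn hx

theorem finalHeight_path (π : CycleAlternating n) : finalHeight π.path = π.1.neg := by
  have := finalHeight_take_eq_height π.length_path π.pos_mem_valleys_iff n le_rfl
  rw [List.take_of_length_le π.length_path.le, sub_self] at this
  rw [this, neg_eq_height]

theorem totalWeight_path (π : CycleAlternating n) : totalWeight π.path = π.cro := by
  rw [← sum_crossingsAt, sum_eq_sum_pos, totalWeight, path, List.map_ofFn, List.sum_ofFn]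
  rfl

/-- The path gives the valleys and the weight at each peak, hence the inverse permutation on peaks;
the sign symmetry carries it over to valleys. -/
theorem path_injective : Function.Injective (path : CycleAlternating n → WeightedPath) := by
  intro π τ h
  have hV : π.valleys = τ.valleys := by
    have hpos : ∀ i, pos i ∈ π.valleys ↔ pos i ∈ τ.valleys := fun i => by
      simp only [pos_mem_valleys_iff, h]
    ext x
    obtain ⟨i, rfl | rfl⟩ := exists_pos x
    · exact hpos i
    · rw [opp_mem_valleys, opp_mem_valleys, hpos]
  have hW : IsClosing π.valleys π.crossingsAt τ.perm.symm := by
    intro p hp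
    have h1 := τ.isClosing p (hV ▸ hp)
    rw [← path_index_snd τ (hV ▸ hp), ← hV] at h1
    rw [← path_index_snd π hp]
    simpa only [h] using h1
  have heq := π.isClosing.eqOn hW
  have hsymm : π.perm.symm = τ.perm.symm := by
    ext1 x
    by_cases hx : x ∈ π.valleys
    · have h1 := heq x.opp (by rwa [opp_mem_valleys, not_not])
      rw [perm_symm_opp, perm_symm_opp] at h1
      exact opp_injective h1
    · exact heq x hx
  have hperm : π.perm = τ.perm := by
    rw [← π.perm.symm_symm, hsymm, Equiv.symm_symm]
  exact Subtype.ext (Subtype.ext hperm)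

/-- A matching sends closers back to openers, so it prescribes the inverse permutation on closers.
The map `ρ` extends it to openers by symmetry and exchanges the two classes, so injectivity can be
checked within each. -/
theorem exists_of_isClosing {V : Finset (Idx n)} (hV : ∀ x, x.opp ∈ V ↔ x ∉ V)
    {W : Idx n → ℕ} {f : Idx n → Idx n} (hf : IsClosing V W f) :
    ∃ π : CycleAlternating n, π.valleys = V ∧ ∀ x ∉ V, π.perm.symm x = f x := by
  have hmem : ∀ x ∉ V, f x ∈ V := fun x hx => by
    have := (hf x hx).1
    simp only [available, Finset.mem_filter] at this
    exact this.2.1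
  have hlt : ∀ x ∉ V, f x < x := fun x hx => by
    have := (hf x hx).1
    simp only [available, Finset.mem_filter] at this
    exact this.2.2.1
  have hne : ∀ x ∉ V, ∀ y ∉ V, x < y → f x ≠ f y := fun x hx y hy hxy => by
    have := (hf y hy).1
    simp only [available, Finset.mem_filter] at this
    exact this.2.2.2 x hxy hx
  have hinj : ∀ x ∉ V, ∀ y ∉ V, f x = f y → x = y := by
    intro x hx y hy hxy
    rcases lt_trichotomy x y with h | h | h
    · exact absurd hxy (hne x hx y hy h)
    · exact h
    · exact absurd hxy.symm (hne y hy x hx h)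
  have hopp : ∀ x ∈ V, x.opp ∉ V := fun x hx => by rwa [hV, not_not]
  let ρ : Idx n → Idx n := fun x => if x ∈ V then (f x.opp).opp else f x
  have hρ1 : ∀ x ∈ V, ρ x = (f x.opp).opp := fun x hx => if_pos hx
  have hρ2 : ∀ x ∉ V, ρ x = f x := fun x hx => if_neg hx
  have hρV : ∀ x, ρ x ∈ V ↔ x ∉ V := by
    intro x
    by_cases hx : x ∈ V
    · rw [hρ1 x hx, hV]
      simp [hx, hmem _ (hopp x hx)]
    · simp [hρ2 x hx, hx, hmem x hx]
  have hρinj : Function.Injective ρ := by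
    intro x y h
    have hxy : x ∉ V ↔ y ∉ V := by rw [← hρV, ← hρV, h]
    by_cases hx : x ∈ V
    · have hy : y ∈ V := by tauto
      rw [hρ1 x hx, hρ1 y hy] at h
      exact opp_injective (hinj _ (hopp x hx) _ (hopp y hy) (opp_injective h))
    · have hy : y ∉ V := by tauto
      rw [hρ2 x hx, hρ2 y hy] at h
      exact hinj x hx y hy h
  have hρopp : ∀ x, ρ x.opp = (ρ x).opp := by
    intro x
    by_cases hx : x ∈ V
    · rw [hρ1 x hx, hρ2 _ (hopp x hx), opp_opp]
    · rw [hρ2 x hx, hρ1 _ ((hV x).mpr hx), opp_opp]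
  have hρlt : ∀ x ∉ V, ρ x < x := fun x hx => hρ2 x hx ▸ hlt x hx
  have hρgt : ∀ x ∈ V, x < ρ x := fun x hx => by
    rw [hρ1 x hx, ← opp_lt_opp, opp_opp]
    exact hlt _ (hopp x hx)
  let σ : Equiv.Perm (Idx n) := (Equiv.ofBijective ρ (Finite.injective_iff_bijective.mp hρinj)).symm
  have hρσ : ∀ x, ρ (σ x) = x := fun x => σ.symm_apply_apply x
  have hσV : ∀ x, σ x ∉ V ↔ x ∈ V := fun x => by rw [← hρV, hρσ]
  have hσgt : ∀ x ∈ V, x < σ x := fun x hx => by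
    have := hρlt (σ x) ((hσV x).mpr hx)
    rwa [hρσ] at this
  have hσlt : ∀ x ∉ V, σ x < x := fun x hx => by
    have := hρgt (σ x) (not_not.mp fun h => hx ((hσV x).mp h))
    rwa [hρσ] at this
  refine ⟨⟨⟨σ, fun x => ?_⟩, fun x => ?_⟩, ?_, hρ2⟩
  · apply hρinj
    rw [hρσ, hρopp, hρσ]
  · by_cases hx : x ∈ V
    · exact Or.inr ⟨hρgt x hx, hσgt x hx⟩
    · exact Or.inl ⟨hρlt x hx, hσlt x hx⟩
  · ext x
    refine mem_valleys.trans ?_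
    change x < σ x ↔ x ∈ V
    exact ⟨fun h => not_not.mp fun hx => lt_asymm h (hσlt x hx), hσgt x⟩

theorem exists_path_eq {p : WeightedPath} (hp : p ∈ restrictedDyckPrefixes n) :
    ∃ π : CycleAlternating n, π.path = p := by
  have hlen : p.length = n := hp.1.1
  have hidx : ∀ x : Idx n, (x.index : ℕ) < p.length := fun x => by rw [hlen]; exact x.index.2
  obtain ⟨V, hV, hpV⟩ : ∃ V : Finset (Idx n), (∀ x, x.opp ∈ V ↔ x ∉ V) ∧
      ∀ i : Fin n, pos i ∈ V ↔ p[i].1 = DyckStep.U := by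
    -- An up step makes the negative position an opener, a down step the positive one.
    refine ⟨Finset.univ.filter fun x => (x.1 < 0 ↔ (p[x.index]'(hidx x)).1 = DyckStep.U),
      fun x => ?_, fun i => ?_⟩
    · have h0 := x.val_ne_zero
      have h1 : x.opp.1 < 0 ↔ ¬ x.1 < 0 := by rw [opp_val]; omega
      simp only [Finset.mem_filter, Finset.mem_univ, true_and, index_opp, h1]
      tauto
    · have h1 : (pos i).1 < 0 := by
        have := i.2
        rw [pos_val]
        omega
      simp only [Finset.mem_filter, Finset.mem_univ, true_and, index_pos, h1, true_iff]
  obtain ⟨f, hf⟩ := exists_isClosing (V := V)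
    (W := fun x => (p[x.index]'(hidx x)).2)
    ((mem_restrictedDyckPrefixes_iff hV hlen hpV).mp hp)
  obtain ⟨π, rfl, hπ⟩ := exists_of_isClosing hV hf
  -- Both sides count the same available openers, since `f` and the inverse of `π` agree on closers.
  have hW : ∀ x ∉ π.valleys, π.crossingsAt x = (p[x.index]'(hidx x)).2 := by
    intro x hx
    have h1 := (hf x hx).2
    rw [← hπ x hx, ← available_congr fun r _ hr => hπ r hr] at h1
    exact (π.isClosing x hx).2.symm.trans h1
  refine ⟨π, List.ext_getElem (by rw [length_path, hlen]) fun i h1 h2 => ?_⟩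
  obtain ⟨j, rfl⟩ : ∃ j : Fin n, (j : ℕ) = i := ⟨⟨i, by omega⟩, rfl⟩
  have hj := (π.pos_mem_valleys_iff j).symm.trans (hpV j)
  simp only [Fin.getElem_fin] at hj
  refine Prod.ext ?_ ?_
  · generalize π.path[j].1 = a at hj ⊢
    generalize p[j].1 = b at hj ⊢
    cases a <;> cases b <;> simp_all
  · by_cases hx : pos j ∈ π.valleys
    · have hx' : (pos j).opp ∉ π.valleys := by rwa [opp_mem_valleys, not_not]
      have h3 := (π.path_index_snd hx').trans (hW _ hx')
      simpa only [index_opp, index_pos, Fin.getElem_fin] using h3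
    · have h3 := (π.path_index_snd hx).trans (hW _ hx)
      simpa only [index_pos, Fin.getElem_fin] using h3

end CycleAlternating

end CycAlt

theorem mainTheorem9 (n : ℕ) :
    ∃ Ψ : CycAlt.CycleAlternating n → CycAlt.restrictedDyckPrefixes n,
      Function.Bijective Ψ ∧
      ∀ π : CycAlt.CycleAlternating n,
        (π.1.neg : ℤ) = CycAlt.finalHeight (Ψ π).1 ∧
        π.cro = CycAlt.totalWeight (Ψ π).1 := by
  refine ⟨fun π => ⟨π.path, π.path_mem⟩, ⟨fun π τ h => ?_, fun p => ?_⟩, fun π => ?_⟩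
  · exact CycAlt.CycleAlternating.path_injective (congrArg Subtype.val h)
  · obtain ⟨π, hπ⟩ := CycAlt.CycleAlternating.exists_path_eq p.2
    exact ⟨π, Subtype.ext hπ⟩
  · exact ⟨π.finalHeight_path.symm, π.totalWeight_path.symm⟩
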